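/- Setting. Let $\Omega\neq\emptyset$ be a state space with an algebra $\mathcal F$ of subsets (events). Let $\mathcal C$ be a mixture space: a set with an operation $(x,\alpha,y)\mapsto \alpha x+(1-\alpha)y$ from $\mathcal C\times[0,1]\times\mathcal C$ to $\mathcal C$ such that $1x+0y=x$, $\alpha x+(1-\alpha)y=(1-\alpha)y+\alpha x$, and $\alpha(\beta x+(1-\beta)y)+(1-\alpha)y=\alpha\beta x+(1-\alpha\beta)y$. Let $\succcurlyeq$ be a binary relation on $\mathcal C$, with asymmetric part $\succ$ and symmetric part $\sim$. A preference interval is a set $S\subseteq\mathcal C$ such that $x,z\in S$ and $x\succcurlyeq y\succcurlyeq z$, $x\succcurlyeq z$ imply $y\in S$. An act is a map $X:\Omega\to\mathcal C$ that is measurable ($X^{-1}(S)\in\mathcal F$ for each preference interval $S$) and bounded (there are outcomes $x\succcurlyeq z$ with $x\succcurlyeq X(\omega)\succcurlyeq z$ for all $\omega$). Constant maps are assumed to be acts and are identified with outcomes. Let $\succcurlyeq$ also denote a binary relation on the set of acts that agrees with the given one on constant acts. Acts are mixed statewise. Since a statewise mixture of acts need not be measurable for an algebra, conditions on mixtures are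 imposed only for mixtures that are acts. Acts $X,Z$ are antimonotonic if there are no states $\omega,\omega'$ with $X(\omega)\succ X(\omega')$ and $Z(\omega)\succ Z(\omega')$. Conditions on the relation on acts. - Weak ordering: it is complete and transitive. - Monotonicity: $X\succcurlyeq Y$ whenever $X(\omega)\succcurlyeq Y(\omega)$ for all $\omega$. - Mixture continuity: for all acts $X,Y,Z$, the sets of $\alpha$ with $\alpha X+(1-\alpha)Z\succcurlyeq Y$ and with $Y\succcurlyeq\alpha X+(1-\alpha)Z$ are closed in the set of those $\alpha\in[0,1]$ for which $\alpha X+(1-\alpha)Z$ is an act. - Strong independence: for all acts $X,Y,Z$ and $0<\alpha<1$, $X\sim Y$ implies $\alpha X+(1-\alpha)Z\sim\alpha Y+(1-\alpha)Z$. - Am-independence: for all antimonotonic acts $X,Z$, all outcomes $x$ and $0<\alpha<1$, $X\sim x$ implies $\alpha X+(1-\alpha)Z\sim\alpha x+(1-\alpha)Z$. A function $U:\mathcal C\to\mathbb R$ is affine if $U(\alpha x+(1-\alpha)y)=\alpha U(x)+(1-\alpha)U(y)$ for all $x,y\in\mathcal C$, $0<\alpha<1$. Subjective expected utility holds with $(P,U)$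 if $P$ is a finitely additive probability measure on $\mathcal F$, $U:\mathcal C\to\mathbb R$, the integral $\int_\Omega U(X)\,dP$ exists and is finite for every act $X$, and $X\succcurlyeq Y\iff\int U(X)\,dP\ge\int U(Y)\,dP$ for all acts $X,Y$. Theorem. The following are equivalent: (i) weak ordering, monotonicity, mixture continuity and strong independence hold; (ii) weak ordering, monotonicity, mixture continuity and am-independence hold; (iii) subjective expected utility holds with some $(P,U)$ with $U$ affine. In (iii), $U$ is an interval scale: if subjective expected utility holds with $(P,U)$ and $U$ is affine, then for all $a>0$, $b\in\mathbb R$ it holds with $(P,aU+b)$, and $aU+b$ is affine; and whenever it holds with $(P',U')$ with $U'$ affine, then $U'=aU+b$ for some $a>0$ and $b\in\mathbb R$. -/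

import Mathlib

open MeasureTheory
open scoped NNReal unitInterval

namespace MixtureSEU

/-- A mixture space: a set with a mixture operation `mix α x y`, written `αx + (1 - α)y` on paper,
for weights `α ∈ [0,1]`. -/
class MixtureSpace (C : Type*) where
  /-- `mix α x y` is the mixture `αx + (1 - α)y`. -/
  mix : I → C → C → C
  mix_one : ∀ x y, mix 1 x y = x
  mix_comm : ∀ α x y, mix α x y = mix (unitInterval.symm α) y x
  mix_assoc : ∀ α β x y, mix α (mix β x y) y = mix (α * β) x y

open MixtureSpace

/-- A real-valued function on a mixture space is affine. -/
def IsAffine {C : Type*} [MixtureSpace C] (U : C → ℝ) : Prop :=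
  ∀ (x y : C) (α : I), 0 < α → α < 1 → U (mix α x y) = α * U x + (1 - α) * U y

section Relations

variable {A : Type*}

/-- The asymmetric part of a relation. -/
def Strict (r : A → A → Prop) (x y : A) : Prop := r x y ∧ ¬ r y x

/-- The symmetric part of a relation. -/
def Indiff (r : A → A → Prop) (x y : A) : Prop := r x y ∧ r y x

/-- Completeness and transitivity. -/
def WeakOrdering (r : A → A → Prop) : Prop :=
  (∀ x y, r x y ∨ r y x) ∧ ∀ x y z, r x y → r y z → r x z

/-- A preference interval: a set of outcomes that contains, with any two of its elements `x ≽ z`,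
all outcomes between them. -/
def IsPreferenceInterval (r : A → A → Prop) (S : Set A) : Prop :=
  ∀ x ∈ S, ∀ z ∈ S, r x z → ∀ y, r x y → r y z → y ∈ S

end Relations

section Acts

variable {Ω C : Type*}

/-- `X` is measurable for the family of events `F` and bounded, both with respect to the
relation `r` (read `≽`) on outcomes. -/
def IsAct (F : Set (Set Ω)) (r : C → C → Prop) (X : Ω → C) : Prop :=
  (∀ S : Set C, IsPreferenceInterval r S → X ⁻¹' S ∈ F) ∧
    ∃ x z : C, r x z ∧ ∀ ω, r x (X ω) ∧ r (X ω) z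

/-- The set of acts: bounded measurable maps from states to outcomes. -/
abbrev Act (F : Set (Set Ω)) (r : C → C → Prop) : Type _ := {X : Ω → C // IsAct F r X}

/-- There are no two states that `X` and `Y` rank strictly in the same direction. -/
def Antimonotonic (r : C → C → Prop) (X Y : Ω → C) : Prop :=
  ¬ ∃ ω ω' : Ω, Strict r (X ω) (X ω') ∧ Strict r (Y ω) (Y ω')

/-- The statewise mixture of two maps. -/
def mixMap [MixtureSpace C] (α : I) (X Y : Ω → C) : Ω → C := fun ω => mix α (X ω) (Y ω)

variable {F : Set (Set Ω)} {r : C → C → Prop}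

/-- Statewise better acts are better. -/
def Monotonicity (pref : Act F r → Act F r → Prop) : Prop :=
  ∀ X Y : Act F r, (∀ ω, r (X.1 ω) (Y.1 ω)) → pref X Y

/-- Mixture continuity. The weights range over those `α ∈ [0,1]` for which the mixture
`αX + (1 - α)Z` is an act, with the subspace topology. -/
def MixtureContinuity [MixtureSpace C] (pref : Act F r → Act F r → Prop) : Prop :=
  ∀ X Y Z : Act F r,
    IsClosed {α : {α : I // IsAct F r (mixMap α X.1 Z.1)} |
      pref ⟨mixMap α.1 X.1 Z.1, α.2⟩ Y} ∧
    IsClosed {α : {α : I // IsAct F r (mixMap α X.1 Z.1)} |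
      pref Y ⟨mixMap α.1 X.1 Z.1, α.2⟩}

/-- Strong independence, for all mixtures that are acts. -/
def StrongIndependence [MixtureSpace C] (pref : Act F r → Act F r → Prop) : Prop :=
  ∀ (X Y Z : Act F r) (α : I), 0 < α → α < 1 →
    ∀ (hX : IsAct F r (mixMap α X.1 Z.1)) (hY : IsAct F r (mixMap α Y.1 Z.1)),
      Indiff pref X Y → Indiff pref ⟨mixMap α X.1 Z.1, hX⟩ ⟨mixMap α Y.1 Z.1, hY⟩

/-- Independence restricted to replacing an act `X` by an indifferent constant act `Y`, in mixtures
with an act `Z` such that `X` and `Z` are antimonotonic. -/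
def AmIndependence [MixtureSpace C] (pref : Act F r → Act F r → Prop) : Prop :=
  ∀ (X Y Z : Act F r), (∃ x : C, ∀ ω, Y.1 ω = x) → Antimonotonic r X.1 Z.1 →
    ∀ α : I, 0 < α → α < 1 →
      ∀ (hX : IsAct F r (mixMap α X.1 Z.1)) (hY : IsAct F r (mixMap α Y.1 Z.1)),
        Indiff pref X Y → Indiff pref ⟨mixMap α X.1 Z.1, hX⟩ ⟨mixMap α Y.1 Z.1, hY⟩

end Acts

section ExpectedUtility

variable {Ω C : Type*} {F : Set (Set Ω)}

/-- The integral of the simple function `ω ↦ a (π ω)`, constant on each cell of the finite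
partition given by the fibres of `π`. -/
noncomputable def simpleIntegral (P : AddContent ℝ≥0 F) {n : ℕ} (π : Ω → Fin n) (a : Fin n → ℝ) :
    ℝ :=
  ∑ i, a i * (P (π ⁻¹' {i}) : ℝ)

/-- The integral of `f` with respect to the finitely additive `P` on `F` exists and equals `c`:
`f` lies between simple functions whose integrals enclose `c` and are arbitrarily close. -/
def HasIntegral (P : AddContent ℝ≥0 F) (f : Ω → ℝ) (c : ℝ) : Prop :=
  ∀ ε : ℝ, 0 < ε → ∃ (n : ℕ) (π : Ω → Fin n) (a b : Fin n → ℝ),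
    (∀ i, π ⁻¹' {i} ∈ F) ∧ (∀ ω, a (π ω) ≤ f ω ∧ f ω ≤ b (π ω)) ∧
      simpleIntegral P π a ≤ c ∧ c ≤ simpleIntegral P π b ∧
      simpleIntegral P π b - simpleIntegral P π a < ε

/-- `P` is a (finitely additive) probability measure, every act has a finite expected utility
`EU X = ∫ U(X) dP`, and `pref` maximizes it. -/
def MaximizesEU {r : C → C → Prop} (pref : Act F r → Act F r → Prop)
    (P : AddContent ℝ≥0 F) (U : C → ℝ) : Prop :=
  P Set.univ = 1 ∧ ∃ EU : Act F r → ℝ,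
    (∀ X : Act F r, HasIntegral P (fun ω => U (X.1 ω)) (EU X)) ∧
      ∀ X Y : Act F r, pref X Y ↔ EU Y ≤ EU X

end ExpectedUtility

end MixtureSEU

open MixtureSEU

/-! The hard implication leads from am-independence to expected utility. A constant act is
antimonotonic to every act, so on outcomes am-independence is ordinary independence, and the
Herstein-Milnor theorem (`IsMixturePreference.exists_affine`) yields an affine `U`. Boundedness,
monotonicity and continuity give each act a certainty equivalent, whose utility is the value `E` of
the act. Replacing both components of a mixture by their certainty equivalents, one after the other,
shows that `E` is affine on antimonotonic pairs of simple acts.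

Antimonotonic pairs suffice for additivity. If two acts improve on a common floor `y` on disjoint
events, then at every state one of them is at its worst, so no state improves both
(`add_of_disjoint`). Hence the value of a simple act is the sum of its improvements cell by cell
(`sum_eq`), and the normalized value of a bet on `A` is additive in `A`: it is `P A`. Bounded acts
are squeezed between simple ones by monotonicity (`IsAntimonotonicAffine.hasIntegral`). Only simple
acts are ever mixed, and their mixtures are again acts, so it does no harm that acts in general are
not closed under mixing.

Conversely, the integral is linear on all mixtures that are acts, which gives strong independence
and continuity at once. Uniqueness of `U` is a matter of constant acts only: two affine functions
that order outcomes alike are affinely related. -/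

namespace MixtureSEU

open MixtureSpace

/-! ### Algebra of mixture spaces -/

section MixtureSpace

variable {C : Type*} [MixtureSpace C]

/-- The weight `γα + (1 - γ)β`. -/
def convexWeight (α β γ : I) : I :=
  ⟨γ * α + (1 - γ) * β, by
    simpa using (convex_Icc (0 : ℝ) 1) α.2 β.2 γ.2.1 (sub_nonneg.2 γ.2.2) (by ring)⟩

lemma mix_zero (x y : C) : mix 0 x y = y := by
  rw [mix_comm, unitInterval.symm_zero, mix_one]

lemma mix_self (α : I) (x : C) : mix α x x = x := by
  have h := mix_assoc α 0 x x
  rwa [mix_zero, mul_zero, mix_zero] at h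

lemma mix_mix_of_le (α β γ δ : I) (x y : C) (hβα : β ≤ α)
    (h : (δ : ℝ) = γ * α + (1 - γ) * β) :
    mix γ (mix α x y) (mix β x y) = mix δ x y := by
  by_cases hα : (α : ℝ) = 0
  · have hα0 : α = 0 := Subtype.ext hα
    have hβ0 : β = 0 := le_antisymm (hα0 ▸ hβα) β.2.1
    have hδ : δ = 0 := Subtype.ext (by rw [h, hα0, hβ0]; simp)
    rw [hα0, hβ0, hδ, mix_zero, mix_self]
  have hpos : (0 : ℝ) < α := lt_of_le_of_ne α.2.1 (Ne.symm hα)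
  have hle : (β : ℝ) ≤ α := hβα
  -- With `w = mix α x y`, the second component is `mix q w y`. Both components are then mixtures of
  -- `w` and `y`, the only situation that the mixture axioms handle directly.
  let q : I := ⟨β / α, div_nonneg β.2.1 α.2.1, (div_le_one hpos).2 hle⟩
  have hβ : β = q * α := Subtype.ext (by simp [q, hα])
  rw [hβ, ← mix_assoc q α x y, mix_comm γ, mix_comm q, mix_assoc, mix_comm, mix_assoc]
  congr 1
  ext
  simp only [Set.Icc.coe_mul, unitInterval.coe_symm_eq, h, q]
  field_simp
  ring

/-- Mixing two mixtures of the same elements averages the weights. -/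
lemma mix_mix (α β γ δ : I) (x y : C) (h : (δ : ℝ) = γ * α + (1 - γ) * β) :
    mix γ (mix α x y) (mix β x y) = mix δ x y := by
  rcases le_total β α with hle | hle
  · exact mix_mix_of_le α β γ δ x y hle h
  · rw [mix_comm]
    refine mix_mix_of_le β α _ δ x y hle ?_
    rw [h, unitInterval.coe_symm_eq]
    ring

lemma IsAffine.map_mix {U : C → ℝ} (hU : IsAffine U) (α : I) (x y : C) :
    U (mix α x y) = α * U x + (1 - α) * U y := by
  rcases eq_or_lt_of_le α.2.1 with h0 | h0
  · have : α = 0 := Subtype.ext h0.symm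
    simp [this, mix_zero]
  rcases eq_or_lt_of_le α.2.2 with h1 | h1
  · have : α = 1 := Subtype.ext h1
    simp [this, mix_one]
  exact hU x y α h0 h1

lemma IsAffine.exists_mix_eq {U : C → ℝ} (hU : IsAffine U) {x y : C} {c : ℝ}
    (hx : c ≤ U x) (hy : U y ≤ c) : ∃ α : I, U (mix α x y) = c := by
  rcases eq_or_lt_of_le (hy.trans hx) with h | h
  · exact ⟨1, by rw [mix_one]; linarith⟩
  have hd : 0 < U x - U y := by linarith
  refine ⟨⟨(c - U y) / (U x - U y), div_nonneg (by linarith) hd.le,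
    (div_le_one hd).2 (by linarith)⟩, ?_⟩
  rw [hU.map_mix]
  field_simp
  ring

end MixtureSpace

/-! ### The Herstein-Milnor theorem and uniqueness of affine utility -/

section HersteinMilnor

variable {C : Type*} [MixtureSpace C]

/-- A continuous weak order on a mixture space that satisfies independence. -/
structure IsMixturePreference (r : C → C → Prop) : Prop where
  total : ∀ x y, r x y ∨ r y x
  trans : ∀ {x y z}, r x y → r y z → r x z
  isClosed_upper : ∀ x y z : C, IsClosed {α : I | r (mix α x z) y}
  isClosed_lower : ∀ x y z : C, IsClosed {α : I | r y (mix α x z)}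
  indep : ∀ (α : I) {x y : C} (z : C), Indiff r x y → Indiff r (mix α x z) (mix α y z)

namespace IsMixturePreference

variable {r : C → C → Prop} (hr : IsMixturePreference r)

include hr

lemma flip : IsMixturePreference (fun x y => r y x) where
  total x y := hr.total y x
  trans h h' := hr.trans h' h
  isClosed_upper := hr.isClosed_lower
  isClosed_lower := hr.isClosed_upper
  indep α _ _ z h := (hr.indep α z h.symm).symm

lemma refl (x : C) : r x x := (hr.total x x).elim id id

lemma indiff_trans {x y z : C} (h : Indiff r x y) (h' : Indiff r y z) : Indiff r x z :=
  ⟨hr.trans h.1 h'.1, hr.trans h'.2 h.2⟩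

lemma indep_right (α : I) {x y : C} (z : C) (h : Indiff r x y) :
    Indiff r (mix α z x) (mix α z y) := by
  rw [mix_comm α z x, mix_comm α z y]
  exact hr.indep _ z h

/-- Two closed sets of weights cover the connected interval `[0,1]`, and each is nonempty, so they
meet. -/
lemma exists_mix_indiff {x y z : C} (hx : r x z) (hy : r z y) :
    ∃ α : I, Indiff r (mix α x y) z := by
  have h := isPreconnected_closed_iff.1 (isPreconnected_univ (α := I)) _ _
    (hr.isClosed_upper x z y) (hr.isClosed_lower x z y)
    (fun α _ => hr.total _ _) ⟨1, trivial, by simpa [mix_one] using hx⟩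
    ⟨0, trivial, by simpa [mix_zero] using hy⟩
  obtain ⟨α, -, h1, h2⟩ := h
  exact ⟨α, h1, h2⟩

/-- Otherwise continuity gives `β < 1` with `mix β x y` indifferent to `x`. Independence iterates
this to all powers `β ^ n`, and in the limit `y` would be at least as good as `x`. -/
lemma strict_mix {x y : C} (h : Strict r x y) {α : I} (hα : α < 1) : Strict r x (mix α x y) := by
  by_contra hn
  have hw : r (mix α x y) x := by
    by_contra hw
    exact hn ⟨(hr.total _ _).resolve_right hw, hw⟩
  obtain ⟨γ, hγ⟩ := hr.exists_mix_indiff hw h.1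
  rw [mix_assoc] at hγ
  set β := γ * α with hβ
  have hβ1 : (β : ℝ) < 1 := lt_of_le_of_lt (by
    rw [hβ, Set.Icc.coe_mul]; exact mul_le_of_le_one_left α.2.1 γ.2.2) hα
  have hn : ∀ n : ℕ, Indiff r (mix (β ^ n) x y) x := by
    intro n
    induction n with
    | zero => rw [pow_zero, mix_one]; exact ⟨hr.refl _, hr.refl _⟩
    | succ n ih =>
      rw [pow_succ, ← mix_assoc]
      exact hr.indiff_trans (hr.indep _ y hγ) ih
  have hlim : Filter.Tendsto (fun n : ℕ => β ^ n) Filter.atTop (nhds 0) := by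
    rw [tendsto_subtype_rng]
    simpa using tendsto_pow_atTop_nhds_zero_of_lt_one β.2.1 hβ1
  have h0 := (hr.isClosed_upper x x y).mem_of_tendsto hlim (Filter.Eventually.of_forall
    fun n => (hn n).1)
  rw [Set.mem_ofPred_eq, mix_zero] at h0
  exact h.2 h0

lemma mix_strict {x y : C} (h : Strict r x y) {α : I} (hα : 0 < α) : Strict r (mix α x y) y := by
  have := hr.flip.strict_mix (x := y) (y := x) h (α := unitInterval.symm α)
    (by rw [← Subtype.coe_lt_coe] at hα ⊢; simpa using hα)
  rwa [← mix_comm] at this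

lemma mix_strict_mix {x y : C} (h : Strict r x y) {α β : I} (hβα : β < α) :
    Strict r (mix α x y) (mix β x y) := by
  have hα : 0 < α := lt_of_le_of_lt β.2.1 hβα
  have hα' : (0 : ℝ) < α := hα
  have hlt : (β : ℝ) < α := hβα
  let q : I := ⟨β / α, div_nonneg β.2.1 α.2.1, (div_le_one hα').2 hlt.le⟩
  have hβ : β = q * α := Subtype.ext (by simp [q, hα'.ne'])
  rw [hβ, ← mix_assoc]
  exact hr.strict_mix (hr.mix_strict h hα) (show q < 1 from (div_lt_one hα').2 hlt)

lemma mix_le_mix_iff {x y : C} (h : Strict r x y) {α β : I} :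
    r (mix α x y) (mix β x y) ↔ β ≤ α := by
  constructor
  · intro hle
    by_contra hlt
    exact (hr.mix_strict_mix h (not_le.1 hlt)).2 hle
  · intro hle
    rcases eq_or_lt_of_le hle with rfl | hlt
    · exact hr.refl _
    · exact (hr.mix_strict_mix h hlt).1

end IsMixturePreference

/-- `u` is an affine representation of `r` on the preference interval between `y` and `x`. -/
structure RepresentsBetween (r : C → C → Prop) (u : C → ℝ) (x y : C) : Prop where
  le_iff : ∀ {w w'}, r x w → r w y → r x w' → r w' y → (r w w' ↔ u w' ≤ u w)
  map_mix : ∀ {w w'}, r x w → r w y → r x w' → r w' y → ∀ α : I,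
    u (mix α w w') = α * u w + (1 - α) * u w'

namespace IsMixturePreference

variable {r : C → C → Prop} (hr : IsMixturePreference r)

include hr

lemma mix_between {x y : C} (h : Strict r x y) {w w' : C} (hw : r x w ∧ r w y)
    (hw' : r x w' ∧ r w' y) (α : I) : r x (mix α w w') ∧ r (mix α w w') y := by
  obtain ⟨a, ha⟩ := hr.exists_mix_indiff hw.1 hw.2
  obtain ⟨b, hb⟩ := hr.exists_mix_indiff hw'.1 hw'.2
  let δ := convexWeight a b α
  have h1 : Indiff r (mix δ x y) (mix α w w') := by
    rw [← mix_mix a b α δ x y rfl]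
    exact hr.indiff_trans (hr.indep α _ ha) (hr.indep_right α _ hb)
  have h2 := (hr.mix_le_mix_iff h (α := 1) (β := δ)).2 δ.2.2
  have h3 := (hr.mix_le_mix_iff h (α := δ) (β := 0)).2 δ.2.1
  rw [mix_one] at h2
  rw [mix_zero] at h3
  exact ⟨hr.trans h2 h1.1, hr.trans h1.2 h3⟩
-- The utility of `w` is the unique weight at which the mixture of `x` and `y` is indifferent to
-- `w`. Independence and `mix_mix` make this calibration affine.
lemma exists_between (x y : C) (h : Strict r x y) : ∃ u, RepresentsBetween r u x y := by
  classical
  have hex : ∀ w, r x w ∧ r w y → ∃ α : I, Indiff r (mix α x y) w :=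
    fun w hw => hr.exists_mix_indiff hw.1 hw.2
  choose! f hf using hex
  have huniq : ∀ w, r x w ∧ r w y → ∀ α : I, Indiff r (mix α x y) w → f w = α := by
    intro w hw α hα
    have h1 := hr.indiff_trans (hf w hw) hα.symm
    exact le_antisymm ((hr.mix_le_mix_iff h).1 h1.2) ((hr.mix_le_mix_iff h).1 h1.1)
  refine ⟨fun w => f w, ?_, ?_⟩
  · intro w w' h1 h2 h1' h2'
    have hw := hf w ⟨h1, h2⟩
    have hw' := hf w' ⟨h1', h2'⟩
    rw [Subtype.coe_le_coe, ← hr.mix_le_mix_iff h]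
    exact ⟨fun hle => hr.trans hw.1 (hr.trans hle hw'.2),
      fun hle => hr.trans hw.2 (hr.trans hle hw'.1)⟩
  · intro w w' h1 h2 h1' h2' α
    have hw := hf w ⟨h1, h2⟩
    have hw' := hf w' ⟨h1', h2'⟩
    rw [huniq _ (hr.mix_between h ⟨h1, h2⟩ ⟨h1', h2'⟩ α) (convexWeight (f w) (f w') α) ?_]
    · rfl
    · rw [← mix_mix (f w) (f w') α _ x y rfl]
      exact hr.indiff_trans (hr.indep α _ hw) (hr.indep_right α _ hw')

end IsMixturePreference

omit [MixtureSpace C] in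
/-- Three elements of a weak order can be listed in descending order. -/
lemma descending_induction {r : C → C → Prop} (htot : ∀ x y, r x y ∨ r y x)
    {D : C → C → C → Prop} (hrot : ∀ p q s, D p q s → D q s p) (hswap : ∀ p q s, D p q s → D q p s)
    (hdesc : ∀ p q s, r p q → r q s → r p s → D p q s) (p q s : C)
    (htrans : ∀ x y z, r x y → r y z → r x z) : D p q s := by
  have key : ∀ p q s, r p q → D p q s := by
    intro p q s hpq
    rcases htot q s with hqs | hsq
    · exact hdesc p q s hpq hqs (htrans _ _ _ hpq hqs)
    rcases htot p s with hps | hsp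
    · exact hswap _ _ _ (hrot _ _ _ (hrot _ _ _ (hdesc p s q hps hsq hpq)))
    · exact hrot _ _ _ (hdesc s p q hsp hpq hsq)
  rcases htot p q with h | h
  · exact key p q s h
  · exact hswap _ _ _ (key q p s h)

/-- Two affine representations are affinely related on the elements that both cover. -/
lemma RepresentsBetween.affinely_related {r : C → C → Prop} (hr : IsMixturePreference r)
    {u v : C → ℝ} {x y x' y' : C} (hu : RepresentsBetween r u x y)
    (hv : RepresentsBetween r v x' y') {p q s : C}
    (hp : (r x p ∧ r p y) ∧ r x' p ∧ r p y') (hq : (r x q ∧ r q y) ∧ r x' q ∧ r q y')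
    (hs : (r x s ∧ r s y) ∧ r x' s ∧ r s y') :
    (u p - u s) * (v q - v s) = (u q - u s) * (v p - v s) := by
  let T := fun w => (r x w ∧ r w y) ∧ r x' w ∧ r w y'
  have hrep : ∀ {w w'}, T w → T w' → Indiff r w w' → u w = u w' ∧ v w = v w' := by
    intro w w' h h' hi
    have a1 := (hu.le_iff h.1.1 h.1.2 h'.1.1 h'.1.2).1 hi.1
    have a2 := (hu.le_iff h'.1.1 h'.1.2 h.1.1 h.1.2).1 hi.2
    have b1 := (hv.le_iff h.2.1 h.2.2 h'.2.1 h'.2.2).1 hi.1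
    have b2 := (hv.le_iff h'.2.1 h'.2.2 h.2.1 h.2.2).1 hi.2
    exact ⟨le_antisymm a2 a1, le_antisymm b2 b1⟩
  -- The determinant identity is invariant under permutations of the three elements. In descending
  -- order the middle one is indifferent to a mixture of the outer two, on which both functions are
  -- affine.
  refine descending_induction hr.total (D := fun p q s => T p → T q → T s →
    (u p - u s) * (v q - v s) = (u q - u s) * (v p - v s)) ?_ ?_ ?_ p q s
    (fun _ _ _ => hr.trans) hp hq hs
  · intro p q s h hq hs hp
    linarith [h hp hq hs]
  · intro p q s h hq hp hs
    linarith [h hp hq hs]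
  · intro p q s hpq hqs hps hp hq hs
    by_cases hsp : r s p
    · obtain ⟨h1, h2⟩ := hrep hp hs ⟨hps, hsp⟩
      rw [h1, h2]
      ring
    · have hst : Strict r p s := ⟨hps, hsp⟩
      obtain ⟨α, hα⟩ := hr.exists_mix_indiff hpq hqs
      have hmem : T (mix α p s) :=
        ⟨⟨hr.trans hq.1.1 hα.2, hr.trans hα.1 hq.1.2⟩,
          hr.trans hq.2.1 hα.2, hr.trans hα.1 hq.2.2⟩
      obtain ⟨h1, h2⟩ := hrep hmem hq hα
      rw [← h1, ← h2, hu.map_mix hp.1.1 hp.1.2 hs.1.1 hs.1.2,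
        hv.map_mix hp.2.1 hp.2.2 hs.2.1 hs.2.2]
      ring

/-- The Herstein-Milnor theorem. -/
theorem IsMixturePreference.exists_affine {r : C → C → Prop} (hr : IsMixturePreference r) :
    ∃ U : C → ℝ, (∀ x y, r x y ↔ U y ≤ U x) ∧ IsAffine U := by
  by_cases hne : ∃ x y, Strict r x y
  swap
  · refine ⟨fun _ => 0, fun x y => ⟨fun _ => le_rfl, fun _ => ?_⟩, fun x y α _ _ => by simp⟩
    by_contra h
    exact hne ⟨y, x, (hr.total x y).resolve_left h, h⟩
  obtain ⟨x₀, y₀, h₀⟩ := hne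
  have hub : ∀ p q, ∃ m, r m p ∧ r m q := fun p q => (hr.total p q).elim
    (fun h => ⟨p, hr.refl p, h⟩) fun h => ⟨q, h, hr.refl q⟩
  have hlb : ∀ p q, ∃ m, r p m ∧ r q m := fun p q => (hr.total p q).elim
    (fun h => ⟨q, h, hr.refl q⟩) fun h => ⟨p, hr.refl p, h⟩
  have hcover : ∀ w w', ∃ x y, (r x x₀ ∧ r y₀ y) ∧ (r x w ∧ r w y) ∧ (r x w' ∧ r w' y) := by
    intro w w'
    obtain ⟨m, hm, hm'⟩ := hub w w'
    obtain ⟨n, hn, hn'⟩ := hlb w w'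
    obtain ⟨x, hx, hxm⟩ := hub x₀ m
    obtain ⟨y, hy, hyn⟩ := hlb y₀ n
    exact ⟨x, y, ⟨hx, hy⟩, ⟨hr.trans hxm hm, hr.trans hn hyn⟩,
      ⟨hr.trans hxm hm', hr.trans hn' hyn⟩⟩
  have hstrict : ∀ {x y}, r x x₀ → r y₀ y → Strict r x y := fun {x y} hx hy =>
    ⟨hr.trans hx (hr.trans h₀.1 hy),
      fun h => h₀.2 (hr.trans hy (hr.trans h hx))⟩
  have hrep : ∀ x y, ∃ u, r x x₀ → r y₀ y → RepresentsBetween r u x y := by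
    intro x y
    by_cases h : Strict r x y
    · obtain ⟨u, hu⟩ := hr.exists_between x y h
      exact ⟨u, fun _ _ => hu⟩
    · exact ⟨fun _ => 0, fun hx hy => absurd (hstrict hx hy) h⟩
  choose u hu using hrep
  choose t b h₀tb htb _ using fun w => hcover w w
  -- Local utilities are normalized to 0 at `y₀` and 1 at `x₀`, which makes them independent of the
  -- interval chosen around `w`.
  let U : C → ℝ := fun w =>
    (u (t w) (b w) w - u (t w) (b w) y₀) / (u (t w) (b w) x₀ - u (t w) (b w) y₀)
  have hx₀ : ∀ {x y}, r x x₀ → r y₀ y → r x x₀ ∧ r x₀ y := fun hx hy =>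
    ⟨hx, hr.trans h₀.1 hy⟩
  have hy₀ : ∀ {x y}, r x x₀ → r y₀ y → r x y₀ ∧ r y₀ y := fun hx hy =>
    ⟨hr.trans hx h₀.1, hy⟩
  have hpos : ∀ {x y}, r x x₀ → r y₀ y → 0 < u x y x₀ - u x y y₀ := by
    intro x y hx hy
    rw [sub_pos]
    refine not_le.1 fun hle => h₀.2 ?_
    exact ((hu x y hx hy).le_iff (hy₀ hx hy).1 (hy₀ hx hy).2 (hx₀ hx hy).1 (hx₀ hx hy).2).2 hle
  have hU : ∀ {x y w}, r x x₀ → r y₀ y → r x w → r w y →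
      u x y w = U w * (u x y x₀ - u x y y₀) + u x y y₀ := by
    intro x y w hx hy hxw hwy
    have h := (hu x y hx hy).affinely_related hr (hu (t w) (b w) (h₀tb w).1 (h₀tb w).2)
      (p := x₀) (q := w) (s := y₀)
      ⟨hx₀ hx hy, hx₀ (h₀tb w).1 (h₀tb w).2⟩ ⟨⟨hxw, hwy⟩, htb w⟩
      ⟨hy₀ hx hy, hy₀ (h₀tb w).1 (h₀tb w).2⟩
    have h1 := hpos (h₀tb w).1 (h₀tb w).2
    simp only [U]
    rw [div_mul_eq_mul_div, eq_comm, ← eq_sub_iff_add_eq, div_eq_iff h1.ne']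
    linarith
  refine ⟨U, fun w w' => ?_, fun w w' α _ _ => ?_⟩
  · obtain ⟨x, y, ⟨hx, hy⟩, hw, hw'⟩ := hcover w w'
    rw [(hu x y hx hy).le_iff hw.1 hw.2 hw'.1 hw'.2, hU hx hy hw.1 hw.2, hU hx hy hw'.1 hw'.2,
      add_le_add_iff_right, mul_le_mul_iff_left₀ (hpos hx hy)]
  · obtain ⟨x, y, ⟨hx, hy⟩, hw, hw'⟩ := hcover w w'
    have hm := hr.mix_between (hstrict hx hy) hw hw' α
    have h := (hu x y hx hy).map_mix hw.1 hw.2 hw'.1 hw'.2 α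
    rw [hU hx hy hw.1 hw.2, hU hx hy hw'.1 hw'.2, hU hx hy hm.1 hm.2] at h
    refine mul_right_cancel₀ (hpos hx hy).ne' ?_
    linarith

/-- An affine representation of a relation is unique up to positive affine transformations. -/
theorem IsAffine.exists_pos_affine {U V : C → ℝ} (hU : IsAffine U) (hV : IsAffine V)
    (h : ∀ x y, U x ≤ U y ↔ V x ≤ V y) : ∃ a b : ℝ, 0 < a ∧ ∀ x, V x = a * U x + b := by
  have heq : ∀ {x y}, U x = U y → V x = V y := fun hxy =>
    le_antisymm ((h _ _).1 hxy.le) ((h _ _).1 hxy.ge)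
  by_cases hne : ∃ x y, U y < U x
  swap
  · rcases isEmpty_or_nonempty C with hC | ⟨⟨c⟩⟩
    · exact ⟨1, 0, one_pos, fun x => hC.elim x⟩
    · have hle : ∀ x y, U x ≤ U y := fun x y => not_lt.1 fun hlt => hne ⟨x, y, hlt⟩
      refine ⟨1, V c - U c, one_pos, fun x => ?_⟩
      have h1 := le_antisymm (hle x c) (hle c x)
      rw [heq h1, h1]
      ring
  obtain ⟨x₀, y₀, h₀⟩ := hne
  have hV₀ : V y₀ < V x₀ := not_le.1 fun hle => not_le.2 h₀ ((h _ _).2 hle)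
  have hpos : 0 < U x₀ - U y₀ := sub_pos.2 h₀
  have hdet : ∀ p q s, (U p - U s) * (V q - V s) = (U q - U s) * (V p - V s) := by
    intro p q s
    refine descending_induction (r := fun x y => U y ≤ U x) (fun x y => le_total _ _)
      (D := fun p q s => (U p - U s) * (V q - V s) = (U q - U s) * (V p - V s))
      (fun p q s h => by linarith) (fun p q s h => by linarith) ?_ p q s
      (fun _ _ _ h h' => h'.trans h)
    intro p q s hpq hqs _
    obtain ⟨α, hα⟩ := hU.exists_mix_eq hpq hqs
    rw [← heq hα, ← hα, hU.map_mix, hV.map_mix]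
    ring
  refine ⟨(V x₀ - V y₀) / (U x₀ - U y₀),
    V y₀ - (V x₀ - V y₀) / (U x₀ - U y₀) * U y₀, div_pos (sub_pos.2 hV₀) hpos, fun w => ?_⟩
  have := hdet x₀ w y₀
  field_simp
  linarith

end HersteinMilnor

/-! ### Simple maps and bets -/

section Simple

variable {Ω ι κ : Type*} {F : Set (Set Ω)}

/-- A map with finite range all of whose preimages belong to `F`. -/
def IsSimple (F : Set (Set Ω)) (X : Ω → ι) : Prop :=
  (Set.range X).Finite ∧ ∀ s, X ⁻¹' s ∈ F

lemma isSimple_of_fibres (hF : IsSetAlgebra F) {X : Ω → ι} (hfin : (Set.range X).Finite)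
    (hX : ∀ i, X ⁻¹' {i} ∈ F) : IsSimple F X := by
  classical
  refine ⟨hfin, fun s => ?_⟩
  have : X ⁻¹' s = ⋃ i ∈ hfin.toFinset.filter (· ∈ s), X ⁻¹' {i} := by
    ext ω
    simp
  rw [this]
  exact hF.biUnion_mem _ fun i _ => hX i

lemma IsSimple.comp {X : Ω → ι} (hX : IsSimple F X) (g : ι → κ) :
    IsSimple F (fun ω => g (X ω)) := by
  refine ⟨?_, fun s => hX.2 (g ⁻¹' s)⟩
  rw [show (fun ω => g (X ω)) = g ∘ X from rfl, Set.range_comp]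
  exact hX.1.image g

lemma IsSimple.prodMk (hF : IsSetAlgebra F) {X : Ω → ι} {Y : Ω → κ} (hX : IsSimple F X)
    (hY : IsSimple F Y) : IsSimple F (fun ω => (X ω, Y ω)) := by
  refine isSimple_of_fibres hF ((hX.1.prod hY.1).subset ?_) fun i => ?_
  · rintro _ ⟨ω, rfl⟩
    exact ⟨⟨ω, rfl⟩, ⟨ω, rfl⟩⟩
  · convert hF.inter_mem (hX.2 {i.1}) (hY.2 {i.2}) using 1
    ext ω
    simp [Prod.ext_iff]

lemma isSimple_const (hF : IsSetAlgebra F) (c : ι) : IsSimple F (fun _ : Ω => c) := by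
  refine ⟨(Set.finite_singleton c).subset (by rintro _ ⟨_, rfl⟩; rfl), fun s => ?_⟩
  by_cases h : c ∈ s
  · simpa [h] using hF.univ_mem
  · simpa [h] using hF.empty_mem

open Classical in
/-- The map equal to `x` on `A` and to `y` off `A`. -/
noncomputable def bet (A : Set Ω) (x y : ι) : Ω → ι := fun ω => if ω ∈ A then x else y

lemma bet_of_mem {A : Set Ω} {x y : ι} {ω : Ω} (h : ω ∈ A) : bet A x y ω = x := if_pos h

lemma bet_of_notMem {A : Set Ω} {x y : ι} {ω : Ω} (h : ω ∉ A) : bet A x y ω = y := if_neg h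

lemma isSimple_bet (hF : IsSetAlgebra F) {A : Set Ω} (hA : A ∈ F) (x y : ι) :
    IsSimple F (bet A x y) := by
  classical
  have h : IsSimple F (fun ω => (decide (ω ∈ A) : Bool)) := by
    refine isSimple_of_fibres hF (Set.toFinite _) fun i => ?_
    cases i
    · convert hF.compl_mem hA using 1
      ext ω
      simp
    · convert hA using 1
      ext ω
      simp
  convert h.comp (fun b : Bool => if b then x else y) using 2 with ω
  simp [bet]

end Simple

/-! ### The finitely additive integral -/

section Integral

variable {Ω : Type*} {F : Set (Set Ω)}

/-- The integral of a function of a map into a finite type. -/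
noncomputable def finIntegral {ι : Type*} [Fintype ι] (P : AddContent ℝ≥0 F) (π : Ω → ι)
    (a : ι → ℝ) : ℝ :=
  ∑ i, a i * (P (π ⁻¹' {i}) : ℝ)

variable (hF : IsSetAlgebra F) (P : AddContent ℝ≥0 F)

include hF

/-- Finite additivity regroups the cells of `π` by the value of `g`. Passing to a common refinement
is the case where `g` is a projection. -/
lemma finIntegral_comp {ι κ : Type*} [Fintype ι] [Fintype κ] {π : Ω → ι} (hπ : IsSimple F π)
    (g : ι → κ) (b : κ → ℝ) :
    finIntegral P (fun ω => g (π ω)) b = finIntegral P π (fun i => b (g i)) := by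
  classical
  have h : ∀ k, (P ((fun ω => g (π ω)) ⁻¹' {k}) : ℝ) =
      ∑ i with g i = k, (P (π ⁻¹' {i}) : ℝ) := by
    intro k
    have he : (fun ω => g (π ω)) ⁻¹' {k} =
        ⋃ i ∈ Finset.univ.filter (fun i => g i = k), π ⁻¹' {i} := by
      ext ω
      simp
    rw [he, addContent_biUnion_eq hF.isSetRing (fun i _ => hπ.2 {i})]
    · push_cast
      rfl
    · intro i _ j _ hij
      exact (Set.disjoint_singleton.2 hij).preimage π
  unfold finIntegral
  rw [← Finset.sum_fiberwise Finset.univ g]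
  refine Finset.sum_congr rfl fun k _ => ?_
  rw [h, Finset.mul_sum]
  refine Finset.sum_congr rfl fun i hi => ?_
  simp only [(Finset.mem_filter.1 hi).2]

lemma finIntegral_const {ι : Type*} [Fintype ι] {π : Ω → ι} (hπ : IsSimple F π)
    (hP : P Set.univ = 1) (c : ℝ) : finIntegral P π (fun _ => c) = c := by
  have h := finIntegral_comp hF P hπ (fun _ => ()) (fun _ => c)
  rw [← h]
  simp [finIntegral, hP]

omit hF in
lemma finIntegral_mono {ι : Type*} [Fintype ι] {π : Ω → ι} {a b : ι → ℝ}
    (h : ∀ ω, a (π ω) ≤ b (π ω)) : finIntegral P π a ≤ finIntegral P π b := by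
  refine Finset.sum_le_sum fun i _ => ?_
  -- The hypothesis says nothing about values that `π` does not take, but their cells are empty and
  -- have measure zero.
  rcases (π ⁻¹' {i}).eq_empty_or_nonempty with he | ⟨ω, hω⟩
  · simp [he]
  · have hi : π ω = i := hω
    exact mul_le_mul_of_nonneg_right (hi ▸ h ω) (NNReal.coe_nonneg _)

omit hF in
lemma finIntegral_linear {ι : Type*} [Fintype ι] (π : Ω → ι) (a b : ι → ℝ) (s t : ℝ) :
    finIntegral P π (fun i => s * a i + t * b i) =
      s * finIntegral P π a + t * finIntegral P π b := by
  simp only [finIntegral, Finset.mul_sum, ← Finset.sum_add_distrib]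
  exact Finset.sum_congr rfl fun i _ => by ring

lemma finIntegral_prod_fst {ι κ : Type*} [Fintype ι] [Fintype κ] {π : Ω → ι} {ρ : Ω → κ}
    (hπ : IsSimple F π) (hρ : IsSimple F ρ) (a : ι → ℝ) :
    finIntegral P π a = finIntegral P (fun ω => (π ω, ρ ω)) (fun i => a i.1) :=
  finIntegral_comp hF P (hπ.prodMk hF hρ) Prod.fst a

lemma finIntegral_prod_snd {ι κ : Type*} [Fintype ι] [Fintype κ] {π : Ω → ι} {ρ : Ω → κ}
    (hπ : IsSimple F π) (hρ : IsSimple F ρ) (b : κ → ℝ) :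
    finIntegral P ρ b = finIntegral P (fun ω => (π ω, ρ ω)) (fun i => b i.2) :=
  finIntegral_comp hF P (hπ.prodMk hF hρ) Prod.snd b

lemma hasIntegral_iff {f : Ω → ℝ} {c : ℝ} :
    HasIntegral P f c ↔ ∀ ε : ℝ, 0 < ε → ∃ (n : ℕ) (π : Ω → Fin n) (a b : Fin n → ℝ),
      IsSimple F π ∧ (∀ ω, a (π ω) ≤ f ω ∧ f ω ≤ b (π ω)) ∧
      finIntegral P π a ≤ c ∧ c ≤ finIntegral P π b ∧
      finIntegral P π b - finIntegral P π a < ε := by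
  refine forall₂_congr fun ε _ => exists_congr fun n => exists_congr fun π =>
    exists_congr fun a => exists_congr fun b => and_congr_left fun _ => ?_
  exact ⟨fun h => isSimple_of_fibres hF (Set.toFinite _) h, fun h i => h.2 {i}⟩

lemma hasIntegral_of_fintype {f : Ω → ℝ} {c : ℝ}
    (h : ∀ ε : ℝ, 0 < ε → ∃ (ι : Type) (_ : Fintype ι) (π : Ω → ι) (a b : ι → ℝ),
      IsSimple F π ∧ (∀ ω, a (π ω) ≤ f ω ∧ f ω ≤ b (π ω)) ∧
      finIntegral P π a ≤ c ∧ c ≤ finIntegral P π b ∧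
      finIntegral P π b - finIntegral P π a < ε) : HasIntegral P f c := by
  rw [hasIntegral_iff hF]
  intro ε hε
  obtain ⟨ι, _, π, a, b, hπ, hab, hac, hcb, hlt⟩ := h ε hε
  let e := Fintype.equivFin ι
  have hi : ∀ a : ι → ℝ, finIntegral P (fun ω => e (π ω)) (fun i => a (e.symm i)) =
      finIntegral P π a := by
    intro a
    rw [finIntegral_comp hF P hπ]
    simp
  refine ⟨Fintype.card ι, fun ω => e (π ω), fun i => a (e.symm i), fun i => b (e.symm i),
    hπ.comp e, by simpa using hab, ?_, ?_, ?_⟩ <;> simpa only [hi]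

variable {P}

lemma HasIntegral.mono {f g : Ω → ℝ} {c d : ℝ} (hf : HasIntegral P f c) (hg : HasIntegral P g d)
    (hfg : ∀ ω, f ω ≤ g ω) : c ≤ d := by
  rw [hasIntegral_iff hF] at hf hg
  refine le_of_forall_pos_le_add fun ε hε => ?_
  obtain ⟨n, π, a, b, hπ, hab, -, hcb, hlt⟩ := hf (ε / 2) (by positivity)
  obtain ⟨m, ρ, a', b', hρ, hab', hac', -, hlt'⟩ := hg (ε / 2) (by positivity)
  -- On the common refinement, the lower bound of `f` lies below the upper bound of `g`.
  have : finIntegral P π a ≤ finIntegral P ρ b' := by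
    rw [finIntegral_prod_fst hF P hπ hρ, finIntegral_prod_snd hF P hπ hρ]
    exact finIntegral_mono P fun ω => (hab ω).1.trans ((hfg ω).trans (hab' ω).2)
  linarith

lemma HasIntegral.unique {f : Ω → ℝ} {c d : ℝ} (hc : HasIntegral P f c)
    (hd : HasIntegral P f d) : c = d :=
  le_antisymm (hc.mono hF hd fun _ => le_rfl) (hd.mono hF hc fun _ => le_rfl)

lemma hasIntegral_const (hP : P Set.univ = 1) (c : ℝ) : HasIntegral P (fun _ => c) c :=
  hasIntegral_of_fintype hF P fun ε hε => ⟨Unit, inferInstance, fun _ => (), fun _ => c,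
    fun _ => c, isSimple_const hF (), fun _ => ⟨le_rfl, le_rfl⟩, by
    rw [finIntegral_const hF P (isSimple_const hF ()) hP]
    simpa using hε⟩

lemma HasIntegral.linear {f g : Ω → ℝ} {c d s t : ℝ} (hf : HasIntegral P f c)
    (hg : HasIntegral P g d) (hs : 0 ≤ s) (ht : 0 ≤ t) :
    HasIntegral P (fun ω => s * f ω + t * g ω) (s * c + t * d) := by
  rw [hasIntegral_iff hF] at hf hg
  refine hasIntegral_of_fintype hF P fun ε hε => ?_
  -- The summand 1 keeps the divisor positive when `s = t = 0`.
  have hM : 0 < s + t + 1 := by positivity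
  obtain ⟨n, π, a, b, hπ, hab, hac, hcb, hlt⟩ := hf (ε / (s + t + 1)) (by positivity)
  obtain ⟨m, ρ, a', b', hρ, hab', hac', hcb', hlt'⟩ := hg (ε / (s + t + 1)) (by positivity)
  have key : ∀ (a : Fin n → ℝ) (a' : Fin m → ℝ),
      finIntegral P (fun ω => (π ω, ρ ω)) (fun i => s * a i.1 + t * a' i.2) =
        s * finIntegral P π a + t * finIntegral P ρ a' := by
    intro a a'
    rw [finIntegral_linear P _ (fun i : Fin n × Fin m => a i.1) (fun i => a' i.2),
      ← finIntegral_prod_fst hF P hπ hρ, ← finIntegral_prod_snd hF P hπ hρ]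
  refine ⟨Fin n × Fin m, inferInstance, fun ω => (π ω, ρ ω), fun i => s * a i.1 + t * a' i.2,
    fun i => s * b i.1 + t * b' i.2, hπ.prodMk hF hρ, fun ω => ⟨?_, ?_⟩, ?_⟩
  · exact add_le_add (mul_le_mul_of_nonneg_left (hab ω).1 hs)
      (mul_le_mul_of_nonneg_left (hab' ω).1 ht)
  · exact add_le_add (mul_le_mul_of_nonneg_left (hab ω).2 hs)
      (mul_le_mul_of_nonneg_left (hab' ω).2 ht)
  rw [key, key]
  refine ⟨add_le_add (mul_le_mul_of_nonneg_left hac hs) (mul_le_mul_of_nonneg_left hac' ht),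
    add_le_add (mul_le_mul_of_nonneg_left hcb hs) (mul_le_mul_of_nonneg_left hcb' ht), ?_⟩
  have h1 := mul_le_mul_of_nonneg_left hlt.le hs
  have h2 := mul_le_mul_of_nonneg_left hlt'.le ht
  have h3 : (s + t + 1) * (ε / (s + t + 1)) = ε := by field_simp
  have h4 : 0 < ε / (s + t + 1) := by positivity
  linarith

end Integral

/-! ### From antimonotonic affinity to an integral -/

section Evaluation

variable {Ω C : Type*} {F : Set (Set Ω)} {r : C → C → Prop} {U : C → ℝ}

lemma IsSimple.isAct [Nonempty Ω] (hrep : ∀ x y, r x y ↔ U y ≤ U x) {X : Ω → C}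
    (hX : IsSimple F X) : IsAct F r X := by
  refine ⟨fun S _ => hX.2 S, ?_⟩
  obtain ⟨_, ⟨ω₁, rfl⟩, h₁⟩ := Set.exists_max_image _ U hX.1 (Set.range_nonempty X)
  obtain ⟨_, ⟨ω₂, rfl⟩, h₂⟩ := Set.exists_min_image _ U hX.1 (Set.range_nonempty X)
  refine ⟨X ω₁, X ω₂, (hrep _ _).2 (h₁ _ ⟨ω₂, rfl⟩), fun ω => ⟨?_, ?_⟩⟩
  · exact (hrep _ _).2 (h₁ _ ⟨ω, rfl⟩)
  · exact (hrep _ _).2 (h₂ _ ⟨ω, rfl⟩)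

lemma IsSimple.mixMap [MixtureSpace C] (hF : IsSetAlgebra F) {X Z : Ω → C} (hX : IsSimple F X)
    (hZ : IsSimple F Z) (α : I) : IsSimple F (mixMap α X Z) :=
  (hX.prodMk hF hZ).comp fun p => mix α p.1 p.2

lemma bet_le {A : Set Ω} {x y : C} (h : U y ≤ U x) (ω : Ω) : U y ≤ U (bet A x y ω) := by
  by_cases hω : ω ∈ A
  · rwa [bet_of_mem hω]
  · rw [bet_of_notMem hω]

/-- A monotone evaluation of acts that extends the affine utility `U` of outcomes and is affine
on antimonotonic pairs of simple acts. -/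
structure IsAntimonotonicAffine [MixtureSpace C] (F : Set (Set Ω)) (r : C → C → Prop) (U : C → ℝ)
    (E : (Ω → C) → ℝ) : Prop where
  affine : IsAffine U
  rep : ∀ x y, r x y ↔ U y ≤ U x
  mono : ∀ {X Y}, IsAct F r X → IsAct F r Y → (∀ ω, U (Y ω) ≤ U (X ω)) → E Y ≤ E X
  const : ∀ c, E (fun _ => c) = U c
  mix : ∀ {X Z}, IsSimple F X → IsSimple F Z → Antimonotonic r X Z → ∀ α : I,
    E (mixMap α X Z) = α * E X + (1 - α) * E Z

namespace IsAntimonotonicAffine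

variable [MixtureSpace C] [Nonempty Ω] {E : (Ω → C) → ℝ} (hF : IsSetAlgebra F)
  (hE : IsAntimonotonicAffine F r U E)

include hE

lemma congr {X Y : Ω → C} (hX : IsSimple F X) (hY : IsSimple F Y)
    (h : ∀ ω, U (X ω) = U (Y ω)) : E X = E Y :=
  le_antisymm (hE.mono (hY.isAct hE.rep) (hX.isAct hE.rep) fun ω => (h ω).le)
    (hE.mono (hX.isAct hE.rep) (hY.isAct hE.rep) fun ω => (h ω).ge)

omit [Nonempty Ω] in
lemma strict_iff {x y : C} : Strict r x y ↔ U y < U x := by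
  rw [Strict, hE.rep, hE.rep, not_le]
  exact ⟨fun h => h.2, fun h => ⟨h.le, h⟩⟩

include hF

omit [Nonempty Ω] in
lemma mix_const {X : Ω → C} (hX : IsSimple F X) (y : C) (α : I) :
    E (mixMap α X fun _ => y) = α * E X + (1 - α) * U y := by
  rw [hE.mix hX (isSimple_const hF y), hE.const]
  rintro ⟨_, _, -, h⟩
  exact h.2 h.1

/-- Acts that improve on `y` on disjoint events are antimonotonic, so the evaluation adds their
improvements up. -/
lemma add_of_disjoint {X₁ X₂ X₃ : Ω → C} {y : C} (h₁ : IsSimple F X₁) (h₂ : IsSimple F X₂)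
    (h₃ : IsSimple F X₃) (hy₁ : ∀ ω, U y ≤ U (X₁ ω)) (hy₂ : ∀ ω, U y ≤ U (X₂ ω))
    (hdisj : ∀ ω, U (X₁ ω) = U y ∨ U (X₂ ω) = U y)
    (hadd : ∀ ω, U (X₃ ω) + U y = U (X₁ ω) + U (X₂ ω)) : E X₃ + U y = E X₁ + E X₂ := by
  have hanti : Antimonotonic r X₁ X₂ := by
    rintro ⟨ω, ω', h, h'⟩
    rw [hE.strict_iff] at h h'
    rcases hdisj ω with h0 | h0
    · linarith [hy₁ ω']
    · linarith [hy₂ ω']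
  -- By `hadd`, the even mixtures of `X₁` with `X₂` and of `X₃` with `y` have the same utility in
  -- every state.
  let α : I := ⟨1 / 2, by norm_num, by norm_num⟩
  have hα : (α : ℝ) = 1 / 2 := rfl
  have e1 := hE.mix h₁ h₂ hanti α
  have e2 := hE.mix_const hF h₃ y α
  have e3 : E (mixMap α X₃ fun _ => y) = E (mixMap α X₁ X₂) := by
    refine hE.congr (h₃.mixMap hF (isSimple_const hF y) α) (h₁.mixMap hF h₂ α) fun ω => ?_
    simp only [MixtureSEU.mixMap]
    rw [hE.affine.map_mix, hE.affine.map_mix, hα]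
    linarith [hadd ω]
  rw [hα] at e1 e2
  linarith

/-- Up to indifference `c` is a mixture of `x` and `y`, so the bet on `c` is a mixture of the bet on
`x` with the constant `y`. -/
lemma bet_eq {A : Set Ω} (hA : A ∈ F) {c x y : C} (hyc : U y ≤ U c) (hcx : U c ≤ U x)
    (hyx : U y < U x) :
    E (bet A c y) - U y = (U c - U y) * ((E (bet A x y) - U y) / (U x - U y)) := by
  obtain ⟨α, hα⟩ := hE.affine.exists_mix_eq hcx hyc
  have h : E (bet A c y) = E (mixMap α (bet A x y) fun _ => y) := by
    refine hE.congr (isSimple_bet hF hA c y)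
      ((isSimple_bet hF hA x y).mixMap hF (isSimple_const hF y) α) fun ω => ?_
    simp only [MixtureSEU.mixMap]
    by_cases hω : ω ∈ A
    · rw [bet_of_mem hω, bet_of_mem hω, hα]
    · rw [bet_of_notMem hω, bet_of_notMem hω, mix_self]
  rw [h, hE.mix_const hF (isSimple_bet hF hA x y), ← hα, hE.affine.map_mix]
  have : U x - U y ≠ 0 := (sub_pos.2 hyx).ne'
  field_simp
  ring

/-- Start from the constant `y` and raise the act to its final values one cell at a time. Each new
improvement is disjoint from the earlier ones. -/
lemma sum_eq {ι : Type*} [Fintype ι] {π : Ω → ι} (hπ : IsSimple F π) {x y : C} (hyx : U y < U x)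
    {g : ι → C} (hy : ∀ i, U y ≤ U (g i)) (hx : ∀ i, U (g i) ≤ U x) :
    E (fun ω => g (π ω)) - U y =
      ∑ i, (U (g i) - U y) * ((E (bet (π ⁻¹' {i}) x y) - U y) / (U x - U y)) := by
  classical
  have key : ∀ s : Finset ι, E (fun ω => if π ω ∈ s then g (π ω) else y) - U y =
      ∑ i ∈ s, (U (g i) - U y) * ((E (bet (π ⁻¹' {i}) x y) - U y) / (U x - U y)) := by
    intro s
    induction s using Finset.induction with
    | empty => simp [hE.const]
    | insert j s hj ih =>
      have hs : ∀ s : Finset ι, IsSimple F (fun ω => if π ω ∈ s then g (π ω) else y) :=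
        fun s => hπ.comp fun i => if i ∈ s then g i else y
      rw [Finset.sum_insert hj, ← ih, ← hE.bet_eq hF (hπ.2 {j}) (hy j) (hx j) hyx]
      have := hE.add_of_disjoint hF (y := y) (isSimple_bet hF (hπ.2 {j}) (g j) y) (hs s)
        (hs (insert j s)) (fun ω => bet_le (hy j) ω)
        (fun ω => by split_ifs; exacts [hy _, le_rfl]) ?_ ?_
      · linarith
      · intro ω
        by_cases hω : π ω = j
        · right
          simp [hω, hj]
        · left
          rw [bet_of_notMem (show ω ∉ π ⁻¹' {j} from hω)]
      · intro ω
        by_cases hω : π ω = j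
        · rw [bet_of_mem (show ω ∈ π ⁻¹' {j} from hω)]
          simp [hω, hj]
        · rw [bet_of_notMem (show ω ∉ π ⁻¹' {j} from hω)]
          simp only [Finset.mem_insert, hω, false_or]
          ring
  simpa using key Finset.univ

/-- The weights of the cells of a partition sum to one. -/
lemma sum_weights {ι : Type*} [Fintype ι] {π : Ω → ι} (hπ : IsSimple F π) {x y : C}
    (hyx : U y < U x) :
    ∑ i, (E (bet (π ⁻¹' {i}) x y) - U y) / (U x - U y) = 1 := by
  have h := hE.sum_eq hF hπ hyx (g := fun _ => x) (fun _ => hyx.le) fun _ => le_rfl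
  rw [← Finset.mul_sum, hE.const] at h
  have hpos := sub_pos.2 hyx
  exact mul_left_cancel₀ hpos.ne' (by linarith)

/-- The weight of an event does not depend on the stakes. -/
lemma weight_eq {A : Set Ω} (hA : A ∈ F) {x₀ y₀ x y : C} (h₀ : U y₀ < U x₀) (hx : U x₀ ≤ U x)
    (hy : U y ≤ U y₀) :
    (E (bet A x y) - U y) / (U x - U y) = (E (bet A x₀ y₀) - U y₀) / (U x₀ - U y₀) := by
  have hyx : U y < U x := by linarith
  have hπ : IsSimple F (bet A true false) := isSimple_bet hF hA _ _
  have hA' : bet A true false ⁻¹' {true} = A := by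
    ext ω
    by_cases hω : ω ∈ A
    · simp [bet_of_mem hω, hω]
    · simp [bet_of_notMem hω, hω]
  have h1 := hE.sum_weights hF hπ hyx
  -- The bet with the smaller stakes is expanded in weights for the larger stakes. The weight of the
  -- complement is eliminated by `h1`.
  have h2 := hE.sum_eq hF hπ hyx (g := fun b => if b then x₀ else y₀)
    (fun b => by cases b <;> simp <;> linarith) (fun b => by cases b <;> simp <;> linarith)
  have h3 : (fun ω => if bet A true false ω then x₀ else y₀) = bet A x₀ y₀ := by
    funext ω
    by_cases hω : ω ∈ A
    · simp [bet_of_mem hω]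
    · simp [bet_of_notMem hω]
  rw [h3] at h2
  rw [Fintype.sum_bool, hA'] at h1 h2
  have h4 : U x₀ - U y₀ ≠ 0 := (sub_pos.2 h₀).ne'
  rw [eq_div_iff h4]
  simp only [if_true, Bool.false_eq_true, if_false] at h2
  rw [← eq_sub_iff_add_eq'] at h1
  rw [h1] at h2
  linarith

lemma exists_addContent {x₀ y₀ : C} (h₀ : U y₀ < U x₀) :
    ∃ P : AddContent ℝ≥0 F, P Set.univ = 1 ∧
      ∀ A ∈ F, (P A : ℝ) = (E (bet A x₀ y₀) - U y₀) / (U x₀ - U y₀) := by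
  have hpos := sub_pos.2 h₀
  let p : Set Ω → ℝ := fun A => (E (bet A x₀ y₀) - U y₀) / (U x₀ - U y₀)
  have hp : ∀ A ∈ F, 0 ≤ p A := fun A hA => by
    refine div_nonneg (sub_nonneg.2 ?_) hpos.le
    rw [← hE.const y₀]
    exact hE.mono ((isSimple_bet hF hA _ _).isAct hE.rep)
      ((isSimple_const hF y₀).isAct hE.rep) fun ω => bet_le h₀.le ω
  have hempty : p ∅ = 0 := by
    have : bet (∅ : Set Ω) x₀ y₀ = fun _ => y₀ := funext fun ω => bet_of_notMem (by simp)
    simp [p, this, hE.const]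
  have huniv : p Set.univ = 1 := by
    have : bet (Set.univ : Set Ω) x₀ y₀ = fun _ => x₀ := funext fun ω => bet_of_mem trivial
    simp [p, this, hE.const, hpos.ne']
  have hadd : ∀ A B, A ∈ F → B ∈ F → Disjoint A B → p (A ∪ B) = p A + p B := by
    intro A B hA hB hAB
    have := hE.add_of_disjoint hF (y := y₀) (isSimple_bet hF hA x₀ y₀) (isSimple_bet hF hB x₀ y₀)
      (isSimple_bet hF (hF.union_mem hA hB) x₀ y₀) (fun ω => bet_le h₀.le ω)
      (fun ω => bet_le h₀.le ω) ?_ ?_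
    · simp only [p]
      rw [← add_div]
      congr 1
      linarith
    · intro ω
      by_cases hω : ω ∈ A
      · right
        rw [bet_of_notMem (Set.disjoint_left.1 hAB hω)]
      · left
        rw [bet_of_notMem hω]
    · intro ω
      by_cases hω : ω ∈ A
      · have hω' := Set.disjoint_left.1 hAB hω
        rw [bet_of_mem (Set.mem_union_left B hω), bet_of_mem hω, bet_of_notMem hω']
      · by_cases hω' : ω ∈ B
        · rw [bet_of_mem (Set.mem_union_right A hω'), bet_of_notMem hω, bet_of_mem hω', add_comm]
        · rw [bet_of_notMem (show ω ∉ A ∪ B from fun h => h.elim hω hω'), bet_of_notMem hω, bet_of_notMem hω']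
  let P : AddContent ℝ≥0 F := hF.isSetRing.addContent_of_union (fun A => (p A).toNNReal)
    (by simp [hempty]) (fun {A B} hA hB hAB => by
      rw [hadd A B hA hB hAB, Real.toNNReal_add (hp A hA) (hp B hB)])
  have hP : ∀ A, P A = (p A).toNNReal := fun A => rfl
  refine ⟨P, by rw [hP, huniv, Real.toNNReal_one], fun A hA => ?_⟩
  rw [hP, Real.coe_toNNReal _ (hp A hA)]

lemma eq_finIntegral {x₀ y₀ : C} (h₀ : U y₀ < U x₀) {P : AddContent ℝ≥0 F}
    (hP1 : P Set.univ = 1)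
    (hP : ∀ A ∈ F, (P A : ℝ) = (E (bet A x₀ y₀) - U y₀) / (U x₀ - U y₀)) {ι : Type*} [Fintype ι]
    {π : Ω → ι} (hπ : IsSimple F π) {x y : C} (hx : U x₀ ≤ U x) (hy : U y ≤ U y₀) {g : ι → C}
    (hgy : ∀ i, U y ≤ U (g i)) (hgx : ∀ i, U (g i) ≤ U x) :
    E (fun ω => g (π ω)) = finIntegral P π fun i => U (g i) := by
  have h := hE.sum_eq hF hπ (by linarith) hgy hgx
  have hc := finIntegral_const hF P hπ hP1 (U y)
  rw [finIntegral] at hc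
  rw [sub_eq_iff_eq_add] at h
  rw [h, finIntegral]
  refine Eq.trans (congrArg (_ + ·) hc.symm) ?_
  rw [← Finset.sum_add_distrib]
  refine Finset.sum_congr rfl fun i _ => ?_
  rw [hE.weight_eq hF (hπ.2 {i}) h₀ hx hy, ← hP _ (hπ.2 {i})]
  ring

/-- The utility range is cut into levels of height `L / n`. Since `U` is affine it attains all
intermediate values, so both step functions are utilities of simple acts, and monotonicity encloses
`E X` between their integrals. -/
theorem hasIntegral {x₀ y₀ : C} (h₀ : U y₀ < U x₀) {P : AddContent ℝ≥0 F}
    (hP1 : P Set.univ = 1)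
    (hP : ∀ A ∈ F, (P A : ℝ) = (E (bet A x₀ y₀) - U y₀) / (U x₀ - U y₀)) {X : Ω → C}
    (hX : IsAct F r X) : HasIntegral P (fun ω => U (X ω)) (E X) := by
  refine hasIntegral_of_fintype hF P fun ε hε => ?_
  obtain ⟨x, y, hx, hy, hXx, hXy⟩ : ∃ x y, U x₀ ≤ U x ∧ U y ≤ U y₀ ∧
      (∀ ω, U (X ω) ≤ U x) ∧ ∀ ω, U y ≤ U (X ω) := by
    obtain ⟨x, y, -, hxy⟩ := hX.2
    obtain ⟨x', h1, h2⟩ : ∃ x', U x₀ ≤ U x' ∧ U x ≤ U x' := (le_total (U x₀) (U x)).elim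
      (fun h => ⟨x, h, le_rfl⟩) fun h => ⟨x₀, le_rfl, h⟩
    obtain ⟨y', h3, h4⟩ : ∃ y', U y' ≤ U y₀ ∧ U y' ≤ U y := (le_total (U y₀) (U y)).elim
      (fun h => ⟨y₀, le_rfl, h⟩) fun h => ⟨y, h, le_rfl⟩
    exact ⟨x', y', h1, h3, fun ω => ((hE.rep _ _).1 (hxy ω).1).trans h2,
      fun ω => h4.trans ((hE.rep _ _).1 (hxy ω).2)⟩
  set L := U x - U y with hL
  have hLpos : 0 < L := by linarith
  obtain ⟨n, hn⟩ := exists_nat_gt (L / ε)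
  have hn0 : (0 : ℝ) < n := lt_trans (by positivity) hn
  have hLn : L / n < ε := by
    rw [div_lt_iff₀ hε] at hn
    rw [div_lt_iff₀ hn0]
    linarith
  -- The `min` is needed for outcomes above `x`. Along `X` the top level `n` occurs only where the
  -- utility equals `U x`.
  let level : C → Fin (n + 1) := fun c =>
    ⟨min ⌊n * ((U c - U y) / L)⌋₊ n, Nat.lt_succ_of_le (min_le_right _ _)⟩
  have hlevel : ∀ {c d}, U c ≤ U d → level c ≤ level d := by
    intro c d h
    refine min_le_min_right n (Nat.floor_mono ?_)
    gcongr
  have hπ : IsSimple F fun ω => level (X ω) := by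
    -- As `level` is monotone in utility, its fibres are preference intervals, to which
    -- measurability of `X` applies.
    refine isSimple_of_fibres hF (Set.toFinite _) fun k => hX.1 (level ⁻¹' {k}) ?_
    intro c hc d hd _ e hce hed
    have h1 := hlevel ((hE.rep _ _).1 hce)
    have h2 := hlevel ((hE.rep _ _).1 hed)
    rw [Set.mem_preimage, Set.mem_singleton_iff] at hc hd ⊢
    exact le_antisymm (hc ▸ h1) (hd ▸ h2)
  let lo : Fin (n + 1) → ℝ := fun k => (k : ℕ) / n
  -- Truncation at 1 keeps the upper value within the range that mixtures of `x` and `y` attain.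
  let up : Fin (n + 1) → ℝ := fun k => min (((k : ℕ) + 1) / n) 1
  have hlo : ∀ k, 0 ≤ lo k ∧ lo k ≤ 1 := fun k =>
    ⟨by positivity, (div_le_one hn0).2 (by exact_mod_cast Nat.le_of_lt_succ k.2)⟩
  have hup : ∀ k, 0 ≤ up k ∧ up k ≤ 1 := fun k =>
    ⟨le_min (by positivity) zero_le_one, min_le_right _ _⟩
  have hgap : ∀ k, up k ≤ lo k + 1 / n := fun k =>
    (min_le_left _ _).trans (add_div _ _ _).le
  have hattain : ∀ t : ℝ, 0 ≤ t ∧ t ≤ 1 → ∃ c, U c = U y + L * t := by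
    intro t ht
    obtain ⟨α, hα⟩ := hE.affine.exists_mix_eq (x := x) (y := y) (c := U y + L * t)
      (by nlinarith) (by nlinarith)
    exact ⟨_, hα⟩
  choose g hg using fun k => hattain (lo k) (hlo k)
  choose h hh using fun k => hattain (up k) (hup k)
  have hfloor : ∀ ω, lo (level (X ω)) ≤ (U (X ω) - U y) / L ∧
      (U (X ω) - U y) / L ≤ up (level (X ω)) := by
    intro ω
    have ht0 : 0 ≤ (U (X ω) - U y) / L := div_nonneg (sub_nonneg.2 (hXy ω)) hLpos.le
    have ht1 : (U (X ω) - U y) / L ≤ 1 := (div_le_one hLpos).2 (by linarith [hXx ω])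
    have hle : ⌊n * ((U (X ω) - U y) / L)⌋₊ ≤ n := by
      rw [← Nat.floor_natCast (R := ℝ) n]
      refine Nat.floor_mono ?_
      simpa using mul_le_of_le_one_right hn0.le ht1
    have hval : ((level (X ω) : ℕ) : ℝ) = (⌊n * ((U (X ω) - U y) / L)⌋₊ : ℕ) := by
      simp only [level, min_eq_left hle]
    simp only [lo, up, hval]
    refine ⟨?_, le_min ?_ ht1⟩
    · rw [div_le_iff₀ hn0, mul_comm _ (n : ℝ)]
      exact Nat.floor_le (by positivity)
    · rw [le_div_iff₀ hn0, mul_comm _ (n : ℝ)]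
      exact (Nat.lt_floor_add_one _).le
  have hbounds : ∀ ω, U (g (level (X ω))) ≤ U (X ω) ∧ U (X ω) ≤ U (h (level (X ω))) := by
    intro ω
    have hU : U (X ω) = U y + L * ((U (X ω) - U y) / L) := by
      field_simp
      ring
    have h1 := mul_le_mul_of_nonneg_left (hfloor ω).1 hLpos.le
    have h2 := mul_le_mul_of_nonneg_left (hfloor ω).2 hLpos.le
    rw [hg, hh]
    constructor <;> linarith
  have hfin : ∀ c : Fin (n + 1) → C, (∀ k, U y ≤ U (c k)) → (∀ k, U (c k) ≤ U x) →
      E (fun ω => c (level (X ω))) = finIntegral P (fun ω => level (X ω)) fun k => U (c k) :=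
    fun c => hE.eq_finIntegral hF h₀ hP1 hP hπ hx hy
  have hunit : ∀ t : ℝ, 0 ≤ t → t ≤ 1 → U y ≤ U y + L * t ∧ U y + L * t ≤ U x :=
    fun t h0 h1 => ⟨by nlinarith, by nlinarith⟩
  have hgu : ∀ k, U y ≤ U (g k) ∧ U (g k) ≤ U x := fun k => by
    rw [hg]
    exact hunit _ (hlo k).1 (hlo k).2
  have hhu : ∀ k, U y ≤ U (h k) ∧ U (h k) ≤ U x := fun k => by
    rw [hh]
    exact hunit _ (hup k).1 (hup k).2
  refine ⟨Fin (n + 1), inferInstance, fun ω => level (X ω), fun k => U (g k), fun k => U (h k),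
    hπ, hbounds, ?_, ?_, ?_⟩
  · rw [← hfin g (fun k => (hgu k).1) fun k => (hgu k).2]
    exact hE.mono hX ((hπ.comp g).isAct hE.rep) fun ω => (hbounds ω).1
  · rw [← hfin h (fun k => (hhu k).1) fun k => (hhu k).2]
    exact hE.mono ((hπ.comp h).isAct hE.rep) hX fun ω => (hbounds ω).2
  · have hle : finIntegral P (fun ω => level (X ω)) (fun k => U (h k)) ≤
        finIntegral P (fun ω => level (X ω)) (fun k => 1 * U (g k) + L / n * 1) := by
      refine finIntegral_mono P fun ω => ?_
      rw [hg, hh]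
      have h1 := mul_le_mul_of_nonneg_left (hgap (level (X ω))) hLpos.le
      have h2 : L * (lo (level (X ω)) + 1 / n) = L * lo (level (X ω)) + L / n * 1 := by ring
      linarith
    rw [finIntegral_linear, finIntegral_const hF P hπ hP1] at hle
    linarith

end IsAntimonotonicAffine

end Evaluation

/-! ### Axioms and expected utility -/

section Representation

variable {Ω C : Type*} [MixtureSpace C] {F : Set (Set Ω)} {r : C → C → Prop}
  {pref : Act F r → Act F r → Prop}

lemma StrongIndependence.amIndependence (h : StrongIndependence pref) : AmIndependence pref :=
  fun X Y Z _ _ α h0 h1 hX hY hXY => h X Y Z α h0 h1 hX hY hXY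

/-- Sections of a mixture-continuous preference along mixtures of constant acts are closed. -/
lemma MixtureContinuity.isClosed_const (hcont : MixtureContinuity pref)
    (hconst : ∀ x : C, IsAct F r (fun _ : Ω => x)) (x z : C) (Y : Act F r) :
    IsClosed {α : I | pref ⟨fun _ => mix α x z, hconst _⟩ Y} ∧
      IsClosed {α : I | pref Y ⟨fun _ => mix α x z, hconst _⟩} := by
  have h := hcont ⟨_, hconst x⟩ Y ⟨_, hconst z⟩
  have hc : Continuous (fun α : I =>
      (⟨α, hconst _⟩ : {α : I // IsAct F r (mixMap α (fun _ : Ω => x) fun _ => z)})) :=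
    Continuous.subtype_mk continuous_id _
  exact ⟨h.1.preimage hc, h.2.preimage hc⟩

lemma isMixturePreference (hconst : ∀ x : C, IsAct F r (fun _ : Ω => x))
    (hagree : ∀ x y : C, pref ⟨fun _ => x, hconst x⟩ ⟨fun _ => y, hconst y⟩ ↔ r x y)
    (hweak : WeakOrdering pref) (hcont : MixtureContinuity pref) (ham : AmIndependence pref) :
    IsMixturePreference r where
  total x y := by
    rw [← hagree, ← hagree]
    exact hweak.1 _ _
  trans h h' := by
    rw [← hagree] at h h' ⊢
    exact hweak.2 _ _ _ h h'
  isClosed_upper x y z := by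
    simpa only [hagree] using (hcont.isClosed_const hconst x z ⟨_, hconst y⟩).1
  isClosed_lower x y z := by
    simpa only [hagree] using (hcont.isClosed_const hconst x z ⟨_, hconst y⟩).2
  indep α x y z h := by
    rcases eq_or_lt_of_le α.2.1 with h0 | h0
    · obtain rfl : α = 0 := Subtype.ext h0.symm
      have : r z z := by
        rw [← hagree]
        exact (hweak.1 _ _).elim id id
      rw [mix_zero, mix_zero]
      exact ⟨this, this⟩
    rcases eq_or_lt_of_le α.2.2 with h1 | h1
    · obtain rfl : α = 1 := Subtype.ext h1
      rwa [mix_one, mix_one]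
    have := ham ⟨_, hconst x⟩ ⟨_, hconst y⟩ ⟨_, hconst z⟩ ⟨y, fun _ => rfl⟩
      (by rintro ⟨ω, _, h, -⟩; exact h.2 h.1) α h0 h1 (hconst (mix α x z))
      (hconst (mix α y z))
      ⟨(hagree _ _).2 h.1, (hagree _ _).2 h.2⟩
    exact ⟨(hagree _ _).1 this.1, (hagree _ _).1 this.2⟩

lemma exists_certaintyEquivalent (hconst : ∀ x : C, IsAct F r (fun _ : Ω => x))
    (hweak : WeakOrdering pref) (hmono : Monotonicity pref) (hcont : MixtureContinuity pref)
    (X : Act F r) : ∃ c, Indiff pref ⟨fun _ => c, hconst c⟩ X := by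
  obtain ⟨x, z, -, hxz⟩ := X.2.2
  have hx : pref ⟨_, hconst x⟩ X := hmono _ _ fun ω => (hxz ω).1
  have hz : pref X ⟨_, hconst z⟩ := hmono _ _ fun ω => (hxz ω).2
  have h := hcont.isClosed_const hconst x z X
  obtain ⟨α, -, h1, h2⟩ := isPreconnected_closed_iff.1 (isPreconnected_univ (α := I)) _ _ h.1 h.2
    (fun α _ => hweak.1 _ _) ⟨1, trivial, by simpa [mix_one] using hx⟩
    ⟨0, trivial, by simpa [mix_zero] using hz⟩
  exact ⟨_, h1, h2⟩

theorem AmIndependence.exists_maximizesEU [Nonempty Ω] (hF : IsSetAlgebra F)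
    (hconst : ∀ x : C, IsAct F r (fun _ : Ω => x))
    (hagree : ∀ x y : C, pref ⟨fun _ => x, hconst x⟩ ⟨fun _ => y, hconst y⟩ ↔ r x y)
    (hweak : WeakOrdering pref) (hmono : Monotonicity pref) (hcont : MixtureContinuity pref)
    (ham : AmIndependence pref) :
    ∃ (P : AddContent ℝ≥0 F) (U : C → ℝ), MaximizesEU pref P U ∧ IsAffine U := by
  classical
  obtain ⟨U, hrep, hU⟩ :=
    (isMixturePreference hconst hagree hweak hcont ham).exists_affine
  choose ce hce using exists_certaintyEquivalent hconst hweak hmono hcont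
  have hpref : ∀ X Y, pref X Y ↔ U (ce Y) ≤ U (ce X) := by
    intro X Y
    rw [← hrep, ← hagree]
    exact ⟨fun h => hweak.2 _ _ _ (hce X).1 (hweak.2 _ _ _ h (hce Y).2),
      fun h => hweak.2 _ _ _ (hce X).2 (hweak.2 _ _ _ h (hce Y).1)⟩
  have hindiff : ∀ X Y, Indiff pref X Y → U (ce X) = U (ce Y) := fun X Y h =>
    le_antisymm ((hpref _ _).1 h.2) ((hpref _ _).1 h.1)
  have hceconst : ∀ c, U (ce ⟨_, hconst c⟩) = U c := by
    intro c
    have h := hce ⟨_, hconst c⟩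
    exact le_antisymm ((hrep _ _).1 ((hagree _ _).1 h.2)) ((hrep _ _).1 ((hagree _ _).1 h.1))
  -- The default 0 is immaterial: `E` is evaluated at acts only.
  let E : (Ω → C) → ℝ := fun X => if h : IsAct F r X then U (ce ⟨X, h⟩) else 0
  have hEval : ∀ X : Act F r, E X.1 = U (ce X) := fun X => dif_pos X.2
  have hreplace : ∀ {X Z : Ω → C}, IsSimple F X → IsSimple F Z → Antimonotonic r X Z →
      ∀ α : I, 0 < α → α < 1 → ∀ x, E X = U x →
      E (mixMap α X Z) = E (mixMap α (fun _ => x) Z) := by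
    intro X Z hX hZ hXZ α h0 h1 x hx
    have hXa := hX.isAct hrep
    have hm1 := (hX.mixMap hF hZ α).isAct hrep
    have hm2 := ((isSimple_const hF x).mixMap hF hZ α).isAct hrep
    rw [hEval ⟨X, hXa⟩] at hx
    rw [hEval ⟨_, hm1⟩, hEval ⟨_, hm2⟩]
    refine hindiff _ _ (ham ⟨X, hXa⟩ ⟨_, hconst x⟩ ⟨Z, hZ.isAct hrep⟩ ⟨x, fun _ => rfl⟩ hXZ α
      h0 h1 hm1 hm2 ⟨?_, ?_⟩) <;> rw [hpref, hceconst, hx]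
  have hmixsymm : ∀ (α : I) (X Z : Ω → C),
      mixMap α X Z = mixMap (unitInterval.symm α) Z X := fun α X Z =>
    funext fun ω => mix_comm α (X ω) (Z ω)
  have hEconst : ∀ c, E (fun _ => c) = U c := fun c =>
    (hEval ⟨_, hconst c⟩).trans (hceconst c)
  have hE : IsAntimonotonicAffine F r U E :=
    { affine := hU
      rep := hrep
      mono := by
        intro X Y hX hY h
        rw [hEval ⟨X, hX⟩, hEval ⟨Y, hY⟩, ← hpref]
        exact hmono _ _ fun ω => (hrep _ _).2 (h ω)
      const := hEconst
      mix := by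
        intro X Z hX hZ hXZ α
        rcases eq_or_lt_of_le α.2.1 with h0 | h0
        · obtain rfl : α = 0 := Subtype.ext h0.symm
          have : mixMap 0 X Z = Z := funext fun ω => mix_zero _ _
          simp [this]
        rcases eq_or_lt_of_le α.2.2 with h1 | h1
        · obtain rfl : α = 1 := Subtype.ext h1
          have : mixMap 1 X Z = X := funext fun ω => mix_one _ _
          simp [this]
        have h0' : 0 < unitInterval.symm α := by
          rw [← Subtype.coe_lt_coe]
          simpa using h1
        have h1' : unitInterval.symm α < 1 := by
          rw [← Subtype.coe_lt_coe]
          simpa using h0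
        have hx := hEval ⟨X, hX.isAct hrep⟩
        have hz := hEval ⟨Z, hZ.isAct hrep⟩
        set x := ce ⟨X, hX.isAct hrep⟩
        set z := ce ⟨Z, hZ.isAct hrep⟩
        have hanti : Antimonotonic r Z fun _ => x := by
          rintro ⟨_, _, -, h⟩
          exact h.2 h.1
        -- Am-independence is used twice: for `X` against `Z`, then for `Z` against the constant
        -- `x`, to which every act is antimonotonic.
        rw [hreplace hX hZ hXZ α h0 h1 x hx, hmixsymm,
          hreplace hZ (isSimple_const hF x) hanti _ h0' h1' z hz, ← hmixsymm,
          show mixMap α (fun _ : Ω => x) (fun _ => z) = fun _ => mix α x z from rfl, hEconst,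
          hU.map_mix, hx, hz] }
  have hmax : ∀ P : AddContent ℝ≥0 F, P Set.univ = 1 →
      (∀ X, IsAct F r X → HasIntegral P (fun ω => U (X ω)) (E X)) → MaximizesEU pref P U :=
    fun P hP h => ⟨hP, fun X => E X.1, fun X => h X.1 X.2, fun X Y => by
      simp only [hpref, hEval]⟩
  by_cases hne : ∃ x₀ y₀, U y₀ < U x₀
  · obtain ⟨x₀, y₀, h₀⟩ := hne
    obtain ⟨P, hP1, hP⟩ := hE.exists_addContent hF h₀
    exact ⟨P, U, hmax P hP1 fun X hX => hE.hasIntegral hF h₀ hP1 hP hX, hU⟩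
  · have heq : ∀ x y, U x = U y := fun x y => le_antisymm
      (not_lt.1 fun h => hne ⟨x, y, h⟩) (not_lt.1 fun h => hne ⟨y, x, h⟩)
    obtain ⟨ω₀⟩ := ‹Nonempty Ω›
    -- If `U` is constant, any probability represents the preference; the point mass at `ω₀` is one.
    let P : AddContent ℝ≥0 F := hF.isSetRing.addContent_of_union
      (fun A => if ω₀ ∈ A then 1 else 0) (by simp) (fun {A B} _ _ hAB => by
        by_cases hA : ω₀ ∈ A
        · simp [hA, Set.disjoint_left.1 hAB hA]
        · simp [hA])
    have hP1 : P Set.univ = 1 := if_pos trivial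
    refine ⟨P, U, hmax P hP1 fun X hX => ?_, hU⟩
    rw [show (fun ω => U (X ω)) = fun _ => E X from
      funext fun ω => (heq _ _).trans (hEval ⟨X, hX⟩).symm]
    exact hasIntegral_const hF hP1 _

omit [MixtureSpace C] in
lemma MaximizesEU.const_iff (hF : IsSetAlgebra F) {P : AddContent ℝ≥0 F} {U : C → ℝ}
    (hconst : ∀ x : C, IsAct F r (fun _ : Ω => x)) (h : MaximizesEU pref P U) (x y : C) :
    pref ⟨fun _ => x, hconst x⟩ ⟨fun _ => y, hconst y⟩ ↔ U y ≤ U x := by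
  obtain ⟨hP, EU, hint, hpref⟩ := h
  rw [hpref, (hint ⟨_, hconst x⟩).unique hF (hasIntegral_const hF hP (U x)),
    (hint ⟨_, hconst y⟩).unique hF (hasIntegral_const hF hP (U y))]

/-- All conditions follow from `hmix`: expected utility is an affine function of the weight wherever
the mixture is an act. Monotonicity also uses that `U` represents `r`, as seen on constant acts. -/
theorem MaximizesEU.conditions (hF : IsSetAlgebra F) {P : AddContent ℝ≥0 F} {U : C → ℝ}
    (hconst : ∀ x : C, IsAct F r (fun _ : Ω => x))
    (hagree : ∀ x y : C, pref ⟨fun _ => x, hconst x⟩ ⟨fun _ => y, hconst y⟩ ↔ r x y)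
    (h : MaximizesEU pref P U) (hU : IsAffine U) :
    WeakOrdering pref ∧ Monotonicity pref ∧ MixtureContinuity pref ∧ StrongIndependence pref := by
  have hrep : ∀ x y, r x y ↔ U y ≤ U x := fun x y =>
    (hagree x y).symm.trans (h.const_iff hF hconst x y)
  obtain ⟨hP, EU, hint, hpref⟩ := h
  have hmix : ∀ (X Z : Act F r) (α : I) (hm : IsAct F r (mixMap α X.1 Z.1)),
      EU ⟨_, hm⟩ = α * EU X + (1 - α) * EU Z := by
    intro X Z α hm
    refine (hint ⟨_, hm⟩).unique hF ?_
    simp only [mixMap, hU.map_mix]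
    exact (hint X).linear hF (hint Z) α.2.1 (sub_nonneg.2 α.2.2)
  refine ⟨⟨fun X Y => ?_, fun X Y Z => ?_⟩, fun X Y h => ?_, fun X Y Z => ⟨?_, ?_⟩,
    fun X Y Z α _ _ hX hY h => ?_⟩
  · rw [hpref, hpref]
    exact le_total _ _
  · rw [hpref, hpref, hpref]
    exact fun h h' => h'.trans h
  · rw [hpref]
    exact (hint Y).mono hF (hint X) fun ω => (hrep _ _).1 (h ω)
  · simp only [hpref, hmix]
    exact isClosed_le (by fun_prop) (by fun_prop)
  · simp only [hpref, hmix]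
    exact isClosed_le (by fun_prop) (by fun_prop)
  · rw [Indiff, hpref, hpref] at h ⊢
    have : EU X = EU Y := le_antisymm h.2 h.1
    rw [hmix, hmix, this]
    exact ⟨le_rfl, le_rfl⟩

omit [MixtureSpace C] in
lemma MaximizesEU.affine_comp (hF : IsSetAlgebra F) {P : AddContent ℝ≥0 F} {U : C → ℝ}
    (h : MaximizesEU pref P U) {a : ℝ} (ha : 0 < a) (b : ℝ) :
    MaximizesEU pref P (fun x => a * U x + b) := by
  obtain ⟨hP, EU, hint, hpref⟩ := h
  refine ⟨hP, fun X => a * EU X + b, fun X => ?_, fun X Y => ?_⟩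
  · simpa using (hint X).linear hF (hasIntegral_const hF hP b) ha.le zero_le_one
  · rw [hpref, add_le_add_iff_right, mul_le_mul_iff_right₀ ha]

end Representation

end MixtureSEU

theorem theorem7 {Ω C : Type*} [Nonempty Ω] [MixtureSpace C]
    -- the algebra of events
    (F : Set (Set Ω)) (hF : IsSetAlgebra F)
    -- the preference relation on outcomes, and its extension to acts; outcomes are identified
    -- with constant maps, which are acts
    (r : C → C → Prop) (pref : Act F r → Act F r → Prop)
    (hconst : ∀ x : C, IsAct F r (fun _ : Ω => x))
    (hagree : ∀ x y : C,
      pref ⟨fun _ => x, hconst x⟩ ⟨fun _ => y, hconst y⟩ ↔ r x y) :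
    List.TFAE
      [WeakOrdering pref ∧ Monotonicity pref ∧ MixtureContinuity pref ∧ StrongIndependence pref,
       WeakOrdering pref ∧ Monotonicity pref ∧ MixtureContinuity pref ∧ AmIndependence pref,
       ∃ (P : AddContent ℝ≥0 F) (U : C → ℝ), MaximizesEU pref P U ∧ IsAffine U] ∧
    ∀ (P : AddContent ℝ≥0 F) (U : C → ℝ), MaximizesEU pref P U → IsAffine U →
      -- positive affine transformations of `U` represent the same preference with the same `P`
      (∀ a b : ℝ, 0 < a → MaximizesEU pref P (fun x => a * U x + b) ∧
        IsAffine (fun x => a * U x + b)) ∧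
      -- and every affine utility in an expected utility representation is one of them
      ∀ (P' : AddContent ℝ≥0 F) (U' : C → ℝ), MaximizesEU pref P' U' → IsAffine U' →
        ∃ a b : ℝ, 0 < a ∧ ∀ x, U' x = a * U x + b := by
  refine ⟨?_, fun P U hmax hU => ⟨fun a b ha => ⟨hmax.affine_comp hF ha b, ?_⟩,
    fun P' U' hmax' hU' => hU.exists_pos_affine hU' fun x y => ?_⟩⟩
  · tfae_have 1 → 2 := fun ⟨h1, h2, h3, h4⟩ => ⟨h1, h2, h3, h4.amIndependence⟩
    tfae_have 2 → 3 := fun ⟨h1, h2, h3, h4⟩ => h4.exists_maximizesEU hF hconst hagree h1 h2 h3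
    tfae_have 3 → 1 := fun ⟨_, _, h, hU⟩ => h.conditions hF hconst hagree hU
    tfae_finish
  · intro x y α h0 h1
    simp only [hU x y α h0 h1]
    ring
  · rw [← hmax.const_iff hF hconst, ← hmax'.const_iff hF hconst]
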